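/- **Setting.** Let $\Lambda\ge 0$ and let $n$ be even. An $n$-message $\Lambda$-penalty weak coin-flipping protocol consists of: finite-dimensional Hilbert spaces $\mathcal A$ (Alice), $\mathcal M$ (message), $\mathcal B$ (Bob); unit vectors $|\psi_{A,0}\rangle,|\psi_{M,0}\rangle,|\psi_{B,0}\rangle$ in them; for $1\le i\le n$ a unitary $U_i$ and an orthogonal projector $E_i$ on $\mathcal A\otimes\mathcal M\otimes\mathcal B$, both acting on $\mathcal A\otimes\mathcal M$ only if $i$ is odd and on $\mathcal M\otimes\mathcal B$ only if $i$ is even; and POVMs $\{\Pi_A^{(x)}\}$ on $\mathcal A$ and $\{\Pi_B^{(x)}\}$ on $\mathcal B$ with outcomes $x\in\{0,1,\bot\}$. Put $|\psi_0\rangle=|\psi_{A,0}\rangle|\psi_{M,0}\rangle|\psi_{B,0}\rangle$ and $|\psi_i\rangle=U_i|\psi_{i-1}\rangle$. It is required that $E_i|\psi_{i-1}\rangle=|\psi_{i-1}\rangle$ for $1\le i\le n$; that $(\Pi_A^{(a)}\otimes\mathbb I_{\mathcal M}\otimes\Pi_B^{(b)})|\psi_n\rangle=0$ unless $a=b\in\{0,1\}$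 (correctness); and that $\|(\Pi_A^{(x)}\otimes\mathbb I_{\mathcal M}\otimes\Pi_B^{(x)})|\psi_n\rangle\|^2=\tfrac12$ for $x=0,1$ (balance). In round $i$ the acting party (Alice for $i$ odd, Bob for $i$ even) receives the register $\mathcal M$, measures $\{E_i,\mathbb I-E_i\}$, stops with output $\bot$ on the second result, and on the first applies $U_i$ and sends $\mathcal M$ to the other party. After round $n$ a party that has not stopped outputs the result of its final POVM. If one party is honest and the other malicious, the malicious party gets $0$ points when the honest party outputs $\bot$; a malicious Bob gets $\Lambda+1$ points when Alice outputs $1$ and $\Lambda$ points when she outputs $0$; a malicious Alice gets $\Lambda+1$ points when Bob outputs $0$ and $\Lambda$ points when he outputs $1$. A malicious party has a private workspace of arbitrary finite dimension, an arbitrary initial joint state of the workspace and $\mathcal M$ (so that a malicious Bob also supplies the message that Alice receives in round $1$), and applies an arbitrary quantum channel to the workspace and $\mathcal M$ in each of its rounds. Let $R_B^*$ (resp. $R_A^*$) be the supremum of the expected number of points of a malicious Bob (resp. Alice) over all such strategies. **Theorem.** (1) The supremum $R_B^*$ is attained, and $$R_B^*=\max\Big[(\Lambda+1)\,\mathrm{tr}\big((\Pi_A^{(1)}\otimes\mathbb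 I_{\mathcal M})\rho_{AM,n}\big)+\Lambda\,\mathrm{tr}\big((\Pi_A^{(0)}\otimes\mathbb I_{\mathcal M})\rho_{AM,n}\big)\Big]$$ over all positive semidefinite operators $\rho_{AM,0},\dots,\rho_{AM,n}$ on $\mathcal A\otimes\mathcal M$ with * $\mathrm{tr}_{\mathcal M}(\rho_{AM,0})=|\psi_{A,0}\rangle\langle\psi_{A,0}|$, * $\mathrm{tr}_{\mathcal M}(\rho_{AM,i})=\mathrm{tr}_{\mathcal M}(U_iE_i\,\rho_{AM,i-1}\,E_iU_i^\dagger)$ for odd $i$, $1\le i\le n$, * $\mathrm{tr}_{\mathcal M}(\rho_{AM,i})=\mathrm{tr}_{\mathcal M}(\rho_{AM,i-1})$ for even $i$, $1\le i\le n$. (2) The supremum $R_A^*$ is attained, and $$R_A^*=\max\Big[(\Lambda+1)\,\mathrm{tr}\big((\mathbb I_{\mathcal M}\otimes\Pi_B^{(0)})\rho_{MB,n}\big)+\Lambda\,\mathrm{tr}\big((\mathbb I_{\mathcal M}\otimes\Pi_B^{(1)})\rho_{MB,n}\big)\Big]$$ over all positive semidefinite operators $\rho_{MB,0},\dots,\rho_{MB,n}$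 on $\mathcal M\otimes\mathcal B$ with * $\mathrm{tr}_{\mathcal M}(\rho_{MB,0})=|\psi_{B,0}\rangle\langle\psi_{B,0}|$, * $\mathrm{tr}_{\mathcal M}(\rho_{MB,i})=\mathrm{tr}_{\mathcal M}(U_iE_i\,\rho_{MB,i-1}\,E_iU_i^\dagger)$ for even $i$, $1\le i\le n$, * $\mathrm{tr}_{\mathcal M}(\rho_{MB,i})=\mathrm{tr}_{\mathcal M}(\rho_{MB,i-1})$ for odd $i$, $1\le i\le n$. All these maxima are attained. (3) If instead Alice herself holds the register $\mathcal M$ in the state $|\psi_{M,0}\rangle$ at the start of round $1$ (so that a malicious Bob's strategy starts with $\mathcal M$ in that state, in product with his workspace), then the corresponding maximal reward of Bob is attained and equals the maximum of the program in (1) with the additional constraint $\rho_{AM,0}=|\psi_{A,0}\rangle\langle\psi_{A,0}|\otimes|\psi_{M,0}\rangle\langle\psi_{M,0}|$. -/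

import Mathlib

open scoped Matrix Kronecker ComplexOrder

noncomputable section

/-- The three possible outputs of a party: `zero` means that Alice wins, `one` means that Bob wins,
and `abort` (written `⊥` in the literature) means that the other party was caught cheating. -/
inductive CoinOutcome
  | zero
  | one
  | abort
  deriving DecidableEq

instance : Fintype CoinOutcome :=
  ⟨{CoinOutcome.zero, CoinOutcome.one, CoinOutcome.abort}, fun x => by cases x <;> simp⟩

/-- The rank-one operator `|ψ⟩⟨ψ|`. -/
def ketBra {X : Type*} (ψ : X → ℂ) : Matrix X X ℂ := Matrix.vecMulVec ψ (star ψ)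

/-- Positive semidefinite with trace one. -/
def IsDensityMatrix {X : Type*} [Fintype X] (ρ : Matrix X X ℂ) : Prop :=
  ρ.PosSemidef ∧ ρ.trace = 1

/-- `T ⊗ 𝟙_Z`, for an operator `T` on the first two of three registers. -/
def actLeft {X Y : Type*} (Z : Type*) [DecidableEq Z] (T : Matrix (X × Y) (X × Y) ℂ) :
    Matrix (X × Y × Z) (X × Y × Z) ℂ :=
  Matrix.reindex (Equiv.prodAssoc X Y Z) (Equiv.prodAssoc X Y Z) (T ⊗ₖ (1 : Matrix Z Z ℂ))

/-- `𝟙_X ⊗ T`, for an operator `T` on the last two of three registers. -/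
def actRight (X : Type*) {Y Z : Type*} [DecidableEq X] (T : Matrix (Y × Z) (Y × Z) ℂ) :
    Matrix (X × Y × Z) (X × Y × Z) ℂ :=
  (1 : Matrix X X ℂ) ⊗ₖ T

/-- Partial trace over the second register. -/
def traceSnd {X Y : Type*} [Fintype Y] (ρ : Matrix (X × Y) (X × Y) ℂ) : Matrix X X ℂ :=
  fun x x' => ∑ y, ρ (x, y) (x', y)

/-- Partial trace over the first register. -/
def traceFst {X Y : Type*} [Fintype X] (ρ : Matrix (X × Y) (X × Y) ℂ) : Matrix Y Y ℂ :=
  fun y y' => ∑ x, ρ (x, y) (x, y')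

/-- An `n`-message cheat-penalised weak coin-flipping protocol with (finite-dimensional) private
registers `A` (Alice), `B` (Bob) and message register `M`, each given by an orthonormal basis.
The penalty enters only through the points, see `CoinOutcome.pointsBob`.
Alice acts in the odd rounds `i` (through `UA i`, `EA i`) and Bob in the even rounds (through
`UB i`, `EB i`), for `1 ≤ i ≤ n`; the values at other indices play no role. In round `i` the acting
party first measures `{E i, 𝟙 - E i}`, outputs `abort` on the second result, and otherwise applies
`U i` and sends `M` to the other party. -/
structure PenWCFData (A M B : Type*) where
  ψA : A → ℂ
  ψM : M → ℂ
  ψB : B → ℂ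
  UA : ℕ → Matrix (A × M) (A × M) ℂ
  UB : ℕ → Matrix (M × B) (M × B) ℂ
  EA : ℕ → Matrix (A × M) (A × M) ℂ
  EB : ℕ → Matrix (M × B) (M × B) ℂ
  measA : CoinOutcome → Matrix A A ℂ
  measB : CoinOutcome → Matrix B B ℂ

namespace PenWCFData

variable {A M B : Type*} [Fintype A] [Fintype M] [Fintype B]
  [DecidableEq A] [DecidableEq M] [DecidableEq B]

/-- The unitary `U i` of round `i` on `A ⊗ M ⊗ B`. -/
def U (P : PenWCFData A M B) (i : ℕ) : Matrix (A × M × B) (A × M × B) ℂ :=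
  if Odd i then actLeft B (P.UA i) else actRight A (P.UB i)

/-- The cheat-detection projector `E i` of round `i` on `A ⊗ M ⊗ B`. -/
def E (P : PenWCFData A M B) (i : ℕ) : Matrix (A × M × B) (A × M × B) ℂ :=
  if Odd i then actLeft B (P.EA i) else actRight A (P.EB i)

/-- The honest states `|ψ_i⟩ = U_i ⋯ U_1 |ψ_0⟩`, with `|ψ_0⟩ = |ψA⟩ ⊗ |ψM⟩ ⊗ |ψB⟩`. -/
def honest (P : PenWCFData A M B) : ℕ → (A × M × B → ℂ)
  | 0 => fun x => P.ψA x.1 * P.ψM x.2.1 * P.ψB x.2.2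
  | i + 1 => P.U (i + 1) *ᵥ honest P i

/-- The operator `Π_A^(a) ⊗ 𝟙_M ⊗ Π_B^(b)`. -/
def jointPOVM (P : PenWCFData A M B) (a b : CoinOutcome) :
    Matrix (A × M × B) (A × M × B) ℂ :=
  P.measA a ⊗ₖ ((1 : Matrix M M ℂ) ⊗ₖ P.measB b)

end PenWCFData

/-- The requirements on an `n`-message weak coin-flipping protocol. -/
structure PenWCFData.IsProtocol {A M B : Type*} [Fintype A] [Fintype M] [Fintype B]
    [DecidableEq A] [DecidableEq M] [DecidableEq B] (P : PenWCFData A M B) (n : ℕ) : Prop where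
  even_n : Even n
  norm_ψA : ∑ a, ‖P.ψA a‖ ^ 2 = 1
  norm_ψM : ∑ m, ‖P.ψM m‖ ^ 2 = 1
  norm_ψB : ∑ b, ‖P.ψB b‖ ^ 2 = 1
  UA_unitary : ∀ i ∈ Finset.Icc 1 n, Odd i → P.UA i ∈ Matrix.unitaryGroup (A × M) ℂ
  UB_unitary : ∀ i ∈ Finset.Icc 1 n, Even i → P.UB i ∈ Matrix.unitaryGroup (M × B) ℂ
  EA_proj : ∀ i ∈ Finset.Icc 1 n, Odd i → IsStarProjection (P.EA i)
  EB_proj : ∀ i ∈ Finset.Icc 1 n, Even i → IsStarProjection (P.EB i)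
  /-- `E i` is measured on the state before `U i`; an honest party always passes. -/
  E_honest : ∀ i ∈ Finset.Icc 1 n, P.E i *ᵥ P.honest (i - 1) = P.honest (i - 1)
  measA_pos : ∀ x, (P.measA x).PosSemidef
  measA_sum : ∑ x, P.measA x = 1
  measB_pos : ∀ x, (P.measB x).PosSemidef
  measB_sum : ∑ x, P.measB x = 1
  correct : ∀ a b, ¬ (a = b ∧ a ≠ .abort) → P.jointPOVM a b *ᵥ P.honest n = 0
  balanced_zero : ∑ x, ‖(P.jointPOVM .zero .zero *ᵥ P.honest n) x‖ ^ 2 = 1 / 2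
  balanced_one : ∑ x, ‖(P.jointPOVM .one .one *ᵥ P.honest n) x‖ ^ 2 = 1 / 2

/-- The points of a malicious Bob, as a function of honest Alice's output. -/
def CoinOutcome.pointsBob (lam : ℝ) : CoinOutcome → ℝ
  | .one => lam + 1
  | .zero => lam
  | .abort => 0

/-- The points of a malicious Alice, as a function of honest Bob's output. -/
def CoinOutcome.pointsAlice (lam : ℝ) : CoinOutcome → ℝ
  | .zero => lam + 1
  | .one => lam
  | .abort => 0

/-- A cheating strategy on the registers `X` (the message register together with a private
workspace) that the cheating party can access in its rounds: an arbitrary (possibly mixed) initial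
state, and in every round of the cheating party an arbitrary quantum channel, given by finitely
many Kraus operators. -/
structure CheatStrategy (X : Type*) [Fintype X] [DecidableEq X] where
  init : Matrix X X ℂ
  init_density : IsDensityMatrix init
  krausCount : ℕ → ℕ
  kraus : (i : ℕ) → Fin (krausCount i) → Matrix X X ℂ
  kraus_complete : ∀ i, ∑ k, (kraus i k)ᴴ * kraus i k = 1

namespace PenWCFData

variable {A M B : Type*} [Fintype A] [Fintype M] [Fintype B]
  [DecidableEq A] [DecidableEq M] [DecidableEq B]

section CheatingBob

variable {d : ℕ}

/-- The unnormalised state of `A ⊗ M ⊗ B'` after round `i` of an execution between honest Alice and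
malicious Bob with workspace `B' = ℂ^d`, on the branch where Alice has not aborted. Its trace is
the probability of that branch. -/
def runBob (P : PenWCFData A M B) (S : CheatStrategy (M × Fin d)) :
    ℕ → Matrix (A × M × Fin d) (A × M × Fin d) ℂ
  | 0 => ketBra P.ψA ⊗ₖ S.init
  | i + 1 =>
    if Odd (i + 1) then
      actLeft (Fin d) (P.UA (i + 1) * P.EA (i + 1)) * runBob P S i *
        (actLeft (Fin d) (P.UA (i + 1) * P.EA (i + 1)))ᴴ
    else
      ∑ k, actRight A (S.kraus (i + 1) k) * runBob P S i * (actRight A (S.kraus (i + 1) k))ᴴ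

/-- The probability that honest Alice detects cheating in one of her rounds `i ≤ n`. -/
def abortProbA (P : PenWCFData A M B) (n : ℕ) (S : CheatStrategy (M × Fin d)) : ℝ :=
  ∑ i ∈ (Finset.Icc 1 n).filter Odd,
    (Matrix.trace (actLeft (Fin d) (1 - P.EA i) * P.runBob S (i - 1))).re

/-- The probability that honest Alice outputs `x`. -/
def outcomeProbA (P : PenWCFData A M B) (n : ℕ) (S : CheatStrategy (M × Fin d))
    (x : CoinOutcome) : ℝ :=
  (Matrix.trace (actLeft (Fin d) (P.measA x ⊗ₖ (1 : Matrix M M ℂ)) * P.runBob S n)).re +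
    if x = .abort then P.abortProbA n S else 0

/-- The expected number of points of malicious Bob. -/
def rewardBob (P : PenWCFData A M B) (n : ℕ) (lam : ℝ) (S : CheatStrategy (M × Fin d)) : ℝ :=
  ∑ x, x.pointsBob lam * P.outcomeProbA n S x

end CheatingBob

section CheatingAlice

variable {d : ℕ}

/-- The unnormalised state of `A' ⊗ M ⊗ B` after round `i` of an execution between malicious Alice
with workspace `A' = ℂ^d` and honest Bob, on the branch where Bob has not aborted. -/
def runAlice (P : PenWCFData A M B) (S : CheatStrategy (Fin d × M)) :
    ℕ → Matrix (Fin d × M × B) (Fin d × M × B) ℂ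
  | 0 => Matrix.reindex (Equiv.prodAssoc (Fin d) M B) (Equiv.prodAssoc (Fin d) M B)
      (S.init ⊗ₖ ketBra P.ψB)
  | i + 1 =>
    if Odd (i + 1) then
      ∑ k, actLeft B (S.kraus (i + 1) k) * runAlice P S i * (actLeft B (S.kraus (i + 1) k))ᴴ
    else
      actRight (Fin d) (P.UB (i + 1) * P.EB (i + 1)) * runAlice P S i *
        (actRight (Fin d) (P.UB (i + 1) * P.EB (i + 1)))ᴴ

/-- The probability that honest Bob detects cheating in one of his rounds `i ≤ n`. -/
def abortProbB (P : PenWCFData A M B) (n : ℕ) (S : CheatStrategy (Fin d × M)) : ℝ :=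
  ∑ i ∈ (Finset.Icc 1 n).filter Even,
    (Matrix.trace (actRight (Fin d) (1 - P.EB i) * P.runAlice S (i - 1))).re

/-- The probability that honest Bob outputs `x`. -/
def outcomeProbB (P : PenWCFData A M B) (n : ℕ) (S : CheatStrategy (Fin d × M))
    (x : CoinOutcome) : ℝ :=
  (Matrix.trace (actRight (Fin d) ((1 : Matrix M M ℂ) ⊗ₖ P.measB x) * P.runAlice S n)).re +
    if x = .abort then P.abortProbB n S else 0

/-- The expected number of points of malicious Alice. -/
def rewardAlice (P : PenWCFData A M B) (n : ℕ) (lam : ℝ) (S : CheatStrategy (Fin d × M)) : ℝ :=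
  ∑ x, x.pointsAlice lam * P.outcomeProbB n S x

end CheatingAlice

/-- All expected rewards that a malicious Bob can reach (with workspaces of any finite dimension)
when the message that Alice receives at the start of round 1 comes from Bob, like every
later one. -/
def rewardsBob (P : PenWCFData A M B) (n : ℕ) (lam : ℝ) : Set ℝ :=
  {r | ∃ (d : ℕ) (S : CheatStrategy (M × Fin d)), r = P.rewardBob n lam S}

/-- All expected rewards that a malicious Bob can reach when Alice herself holds the message
register at the start of round 1, in the state `|ψM⟩`. -/
def rewardsBobHeld (P : PenWCFData A M B) (n : ℕ) (lam : ℝ) : Set ℝ :=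
  {r | ∃ (d : ℕ) (S : CheatStrategy (M × Fin d)),
    (∃ τ : Matrix (Fin d) (Fin d) ℂ, IsDensityMatrix τ ∧ S.init = ketBra P.ψM ⊗ₖ τ) ∧
    r = P.rewardBob n lam S}

/-- All expected rewards that a malicious Alice can reach. -/
def rewardsAlice (P : PenWCFData A M B) (n : ℕ) (lam : ℝ) : Set ℝ :=
  {r | ∃ (d : ℕ) (S : CheatStrategy (Fin d × M)), r = P.rewardAlice n lam S}

/-- The cheating reward `R_B^*` of Bob (Bob supplies the first incoming message). -/
def RB (P : PenWCFData A M B) (n : ℕ) (lam : ℝ) : ℝ := sSup (P.rewardsBob n lam)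

/-- The cheating reward of Bob when Alice starts with `|ψM⟩` in her possession. -/
def RBHeld (P : PenWCFData A M B) (n : ℕ) (lam : ℝ) : ℝ := sSup (P.rewardsBobHeld n lam)

/-- The cheating reward `R_A^*` of Alice. -/
def RA (P : PenWCFData A M B) (n : ℕ) (lam : ℝ) : ℝ := sSup (P.rewardsAlice n lam)

/-- The constraints of the primal semidefinite program for a malicious Bob, on the operators
`ρ_{AM,0}, …, ρ_{AM,n}`. -/
structure FeasibleBob (P : PenWCFData A M B) (n : ℕ)
    (ρ : ℕ → Matrix (A × M) (A × M) ℂ) : Prop where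
  pos : ∀ i ≤ n, (ρ i).PosSemidef
  start : traceSnd (ρ 0) = ketBra P.ψA
  odd : ∀ i ∈ Finset.Icc 1 n, Odd i →
    traceSnd (ρ i) = traceSnd (P.UA i * P.EA i * ρ (i - 1) * P.EA i * (P.UA i)ᴴ)
  even : ∀ i ∈ Finset.Icc 1 n, Even i → traceSnd (ρ i) = traceSnd (ρ (i - 1))

/-- The constraints of the primal semidefinite program for a malicious Alice, on the operators
`ρ_{MB,0}, …, ρ_{MB,n}`. -/
structure FeasibleAlice (P : PenWCFData A M B) (n : ℕ)
    (ρ : ℕ → Matrix (M × B) (M × B) ℂ) : Prop where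
  pos : ∀ i ≤ n, (ρ i).PosSemidef
  start : traceFst (ρ 0) = ketBra P.ψB
  even : ∀ i ∈ Finset.Icc 1 n, Even i →
    traceFst (ρ i) = traceFst (P.UB i * P.EB i * ρ (i - 1) * P.EB i * (P.UB i)ᴴ)
  odd : ∀ i ∈ Finset.Icc 1 n, Odd i → traceFst (ρ i) = traceFst (ρ (i - 1))

/-- `(Λ + 1) tr((Π_A^(1) ⊗ 𝟙_M) ρ) + Λ tr((Π_A^(0) ⊗ 𝟙_M) ρ)`. -/
def objectiveBob (P : PenWCFData A M B) (lam : ℝ) (ρ : Matrix (A × M) (A × M) ℂ) : ℝ :=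
  (lam + 1) * (Matrix.trace ((P.measA .one ⊗ₖ (1 : Matrix M M ℂ)) * ρ)).re +
    lam * (Matrix.trace ((P.measA .zero ⊗ₖ (1 : Matrix M M ℂ)) * ρ)).re

/-- `(Λ + 1) tr((𝟙_M ⊗ Π_B^(0)) ρ) + Λ tr((𝟙_M ⊗ Π_B^(1)) ρ)`. -/
def objectiveAlice (P : PenWCFData A M B) (lam : ℝ) (ρ : Matrix (M × B) (M × B) ℂ) : ℝ :=
  (lam + 1) * (Matrix.trace (((1 : Matrix M M ℂ) ⊗ₖ P.measB .zero) * ρ)).re +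
    lam * (Matrix.trace (((1 : Matrix M M ℂ) ⊗ₖ P.measB .one) * ρ)).re

end PenWCFData

end

/-! The points depend only on the final marginal of the honest private register, since an abort
earns nothing. It thus suffices to compare the marginals that strategies reach with those that the
program allows.

Every run is feasible (`honestRun_feasible`): tracing out the workspace commutes with the honest
operations `K i = U i * E i`, and a channel on message and workspace preserves the honest marginal.

Conversely (`HonestFeasible.exists_strategy`), each `ρ i` is purified with a workspace of dimension
`card (X × Y)`. In a round of the cheating party the state before and the purification after have
the same honest marginal, so a unitary on message and workspace maps one to the other
(`exists_unitary_actRight`). After an honest round the reduced state may differ from `ρ i`, but the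
honest marginal agrees; this is enough because no two honest rounds are consecutive. For a freely
chosen first message, the pure marginal `ketBra ψ` makes the initial purification a product
(`HonestFeasible.exists_start`).

Both sets of values are therefore equal. The maximum exists because the feasible sequences,
truncated at `n`, form a nonempty compact set on which the objective is continuous. Cheating Alice
reduces to the same statement by reversing the registers; the variant with the message held by Alice
only fixes `ρ 0`. -/

/-! ### Unitary freedom of matrices with equal Gram matrix -/

/-- The assignment `f v ↦ g v` is well defined and isometric on the range of `f`. It extends to an
isometry of `W`, which is onto by finite dimension. -/
theorem LinearMap.exists_linearIsometryEquiv_apply_eq {V W : Type*} [AddCommGroup V] [Module ℂ V]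
    [NormedAddCommGroup W] [InnerProductSpace ℂ W] [FiniteDimensional ℂ W] (f g : V →ₗ[ℂ] W)
    (h : ∀ v, ‖f v‖ = ‖g v‖) : ∃ L : W ≃ₗᵢ[ℂ] W, ∀ v, L (f v) = g v := by
  have hker : LinearMap.ker f ≤ LinearMap.ker g := fun v hv => by
    rw [LinearMap.mem_ker] at hv ⊢
    rw [← norm_eq_zero, ← h, hv, norm_zero]
  let T : LinearMap.range f →ₗ[ℂ] W :=
    (LinearMap.ker f).liftQ g hker ∘ₗ f.quotKerEquivRange.symm.toLinearMap
  have hT : ∀ v, T ⟨f v, LinearMap.mem_range_self f v⟩ = g v := fun v => by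
    have : f.quotKerEquivRange.symm ⟨f v, LinearMap.mem_range_self f v⟩
        = (LinearMap.ker f).mkQ v := by
      rw [LinearEquiv.symm_apply_eq]; rfl
    simp only [T, LinearMap.comp_apply, LinearEquiv.coe_coe, this]
    simp
  let T' : LinearMap.range f →ₗᵢ[ℂ] W := ⟨T, by
    rintro ⟨_, v, rfl⟩
    rw [hT, ← h]; rfl⟩
  refine ⟨T'.extend.toLinearIsometryEquiv rfl, fun v => ?_⟩
  have := T'.extend_apply ⟨f v, LinearMap.mem_range_self f v⟩
  exact this.trans (hT v)

theorem Matrix.exists_unitary_mul_eq {h k : Type*} [Fintype h] [Fintype k] [DecidableEq h]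
    [DecidableEq k] (X Y : Matrix k h ℂ) (hXY : Xᴴ * X = Yᴴ * Y) :
    ∃ V ∈ Matrix.unitaryGroup k ℂ, V * X = Y := by
  -- The norm of `Z v` depends on `Z` only through the Gram matrix `Zᴴ * Z`.
  have key : ∀ (Z : Matrix k h ℂ) (v : EuclideanSpace ℂ h),
      ((‖Matrix.toEuclideanLin Z v‖ ^ 2 : ℝ) : ℂ) = star v.ofLp ⬝ᵥ ((Zᴴ * Z) *ᵥ v.ofLp) := by
    intro Z v
    have := inner_self_eq_norm_sq_to_K (𝕜 := ℂ) (Matrix.toEuclideanLin Z v)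
    rw [EuclideanSpace.inner_eq_star_dotProduct] at this
    push_cast
    refine Eq.trans this.symm ?_
    rw [← Matrix.mulVec_mulVec, Matrix.dotProduct_mulVec, Matrix.vecMul_conjTranspose, star_star,
      dotProduct_comm]
    rfl
  obtain ⟨L, hL⟩ := LinearMap.exists_linearIsometryEquiv_apply_eq
    (Matrix.toEuclideanLin X) (Matrix.toEuclideanLin Y) (fun v => by
      have h1 := key X v
      rw [hXY, ← key Y v] at h1
      exact (sq_eq_sq₀ (norm_nonneg _) (norm_nonneg _)).1 (by exact_mod_cast h1))
  let b := EuclideanSpace.basisFun k ℂ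
  refine ⟨L.toMatrix b.toBasis b.toBasis, L.toMatrix_mem_unitaryGroup b b, ?_⟩
  ext i j
  have h2 := congrFun
      (LinearMap.toMatrix_mulVec_repr b.toBasis b.toBasis L.toLinearEquiv.toLinearMap
    (Matrix.toEuclideanLin X (WithLp.toLp 2 (Pi.single j 1)))) i
  simpa [b, hL, Matrix.toEuclideanLin, Matrix.mulVec, dotProduct, Matrix.mul_apply,
    Pi.single_apply] using h2

/-- Partial trace over the last of three registers. -/
noncomputable def traceLast {X Y Z : Type*} [Fintype Z] (σ : Matrix (X × Y × Z) (X × Y × Z) ℂ) :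
    Matrix (X × Y) (X × Y) ℂ :=
  fun x y => ∑ z, σ (x.1, x.2, z) (y.1, y.2, z)

/-! ### Partial traces and purifications -/

section PartialTrace

variable {X Y Z : Type*}

theorem traceLast_posSemidef [Fintype Z] {σ : Matrix (X × Y × Z) (X × Y × Z) ℂ} (h : σ.PosSemidef) :
    (traceLast σ).PosSemidef := by
  have : traceLast σ = ∑ z, σ.submatrix (fun x : X × Y => (x.1, x.2, z))
      (fun x => (x.1, x.2, z)) := by
    ext x y; simp [traceLast, Matrix.sum_apply]
  rw [this]
  exact Matrix.posSemidef_sum _ fun z _ => h.submatrix _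

theorem trace_traceSnd [Fintype X] [Fintype Y] (ρ : Matrix (X × Y) (X × Y) ℂ) : (traceSnd ρ).trace =
    ρ.trace := by
  simp [Matrix.trace, traceSnd, Fintype.sum_prod_type]

theorem traceSnd_kronecker [Fintype Y] (S : Matrix X X ℂ) (T : Matrix Y Y ℂ) :
    traceSnd (S ⊗ₖ T) = T.trace • S := by
  ext x y
  simp [traceSnd, Matrix.trace, ← Finset.mul_sum, mul_comm]

theorem traceSnd_traceLast_kronecker [Fintype X] [Fintype Y] [Fintype Z] (S : Matrix X X ℂ)
    (T : Matrix (Y × Z) (Y × Z) ℂ) :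
    traceSnd (traceLast (S ⊗ₖ T)) = T.trace • S := by
  rw [← traceSnd_kronecker]
  ext x y
  simp [traceSnd, traceLast, Fintype.sum_prod_type]

theorem traceLast_kronecker_kronecker [Fintype Z] (S : Matrix X X ℂ) (T : Matrix Y Y ℂ)
    (R : Matrix Z Z ℂ) :
    traceLast (S ⊗ₖ (T ⊗ₖ R)) = R.trace • (S ⊗ₖ T) := by
  ext x y
  simp [traceLast, Matrix.trace, ← Finset.mul_sum, mul_comm, mul_assoc]

theorem traceSnd_traceLast [Fintype Y] [Fintype Z] (σ : Matrix (X × Y × Z) (X × Y × Z) ℂ) :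
    traceSnd (traceLast σ) = traceSnd (Y := Y × Z) σ := by
  ext x y
  simp [traceSnd, traceLast, Fintype.sum_prod_type]

theorem traceSnd_sum [Fintype Y] {ι : Type*} (s : Finset ι) (f : ι → Matrix (X × Y) (X × Y) ℂ) :
    traceSnd (∑ k ∈ s, f k) = ∑ k ∈ s, traceSnd (f k) := by
  ext x y
  simp only [traceSnd, Matrix.sum_apply]
  exact Finset.sum_comm

theorem trace_kronecker_one_mul [Fintype X] [Fintype Y] [DecidableEq Y] (R : Matrix X X ℂ)
    (ρ : Matrix (X × Y) (X × Y) ℂ) :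
    ((R ⊗ₖ (1 : Matrix Y Y ℂ)) * ρ).trace = (R * traceSnd ρ).trace := by
  simp only [Matrix.trace, Matrix.diag_apply, Matrix.mul_apply, Fintype.sum_prod_type, traceSnd,
    Matrix.kroneckerMap_apply, Matrix.one_apply, mul_ite, mul_one, mul_zero, ite_mul, zero_mul,
    Finset.sum_ite_eq, Finset.mem_univ, if_true, Finset.mul_sum]
  exact Finset.sum_congr rfl fun x _ => Finset.sum_comm

theorem actLeft_apply [DecidableEq Z] (T : Matrix (X × Y) (X × Y) ℂ) (x y : X × Y × Z) :
    actLeft Z T x y = T (x.1, x.2.1) (y.1, y.2.1) * (1 : Matrix Z Z ℂ) x.2.2 y.2.2 := rfl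

theorem traceLast_actLeft_mul [Fintype X] [Fintype Y] [Fintype Z] [DecidableEq Z]
    (T : Matrix (X × Y) (X × Y) ℂ)
    (σ : Matrix (X × Y × Z) (X × Y × Z) ℂ) :
    traceLast (actLeft Z T * σ) = T * traceLast σ := by
  ext x y
  simp only [traceLast, Matrix.mul_apply, Fintype.sum_prod_type, actLeft_apply, Matrix.one_apply,
    mul_ite, mul_one, mul_zero, ite_mul, zero_mul, Finset.sum_ite_eq, Finset.mem_univ, if_true,
    Finset.mul_sum]
  rw [Finset.sum_comm]
  exact Finset.sum_congr rfl fun x _ => Finset.sum_comm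

theorem actLeft_conjTranspose [DecidableEq Z] (T : Matrix (X × Y) (X × Y) ℂ) :
    (actLeft Z T)ᴴ = actLeft Z Tᴴ := by
  ext x y
  by_cases h : x.2.2 = y.2.2
  · rw [Matrix.conjTranspose_apply, actLeft_apply, actLeft_apply, h]
    simp
  · simp [actLeft_apply, h, Ne.symm h]

theorem actRight_conjTranspose [DecidableEq X] (T : Matrix (Y × Z) (Y × Z) ℂ) :
    (actRight X T)ᴴ = actRight X Tᴴ := by
  simp [actRight, Matrix.conjTranspose_kronecker]

theorem traceLast_conjTranspose [Fintype Z] (σ : Matrix (X × Y × Z) (X × Y × Z) ℂ) :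
    (traceLast σ)ᴴ = traceLast σᴴ := by
  ext x y
  simp [traceLast]

theorem traceLast_mul_actLeft [Fintype X] [Fintype Y] [Fintype Z] [DecidableEq Z]
    (T : Matrix (X × Y) (X × Y) ℂ)
    (σ : Matrix (X × Y × Z) (X × Y × Z) ℂ) :
    traceLast (σ * actLeft Z T) = traceLast σ * T := by
  apply Matrix.conjTranspose_injective
  rw [traceLast_conjTranspose, Matrix.conjTranspose_mul, actLeft_conjTranspose,
    traceLast_actLeft_mul, Matrix.conjTranspose_mul, traceLast_conjTranspose]

/-- Cyclicity of the partial trace for operators on the traced register. -/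
theorem traceSnd_one_kronecker_mul [Fintype X] [Fintype Y] [DecidableEq X] (T : Matrix Y Y ℂ)
    (ρ : Matrix (X × Y) (X × Y) ℂ) :
    traceSnd (((1 : Matrix X X ℂ) ⊗ₖ T) * ρ) = traceSnd (ρ * ((1 : Matrix X X ℂ) ⊗ₖ T)) := by
  ext x y
  simp only [traceSnd, Matrix.mul_apply, Fintype.sum_prod_type, Matrix.kroneckerMap_apply,
    Matrix.one_apply, ite_mul, one_mul, zero_mul, mul_ite, mul_zero]
  simp only [Finset.sum_comm (s := (Finset.univ : Finset X)), Finset.sum_ite_eq,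
    Finset.sum_ite_eq', Finset.mem_univ, if_true]
  rw [Finset.sum_comm]
  exact Finset.sum_congr rfl fun _ _ => Finset.sum_congr rfl fun _ _ => mul_comm _ _

/-- A channel on the last two registers preserves the reduced state of the first one. -/
theorem traceSnd_sum_actRight [Fintype X] [Fintype Y] [Fintype Z] [DecidableEq X] [DecidableEq Y]
    [DecidableEq Z] {N : ℕ}
    (K : Fin N → Matrix (Y × Z) (Y × Z) ℂ)
    (hK : ∑ k, (K k)ᴴ * K k = 1) (σ : Matrix (X × Y × Z) (X × Y × Z) ℂ) :
    traceSnd (Y := Y × Z) (∑ k, actRight X (K k) * σ * (actRight X (K k))ᴴ) =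
      traceSnd (Y := Y × Z) σ := by
  have h : ∀ k, traceSnd (Y := Y × Z) (actRight X (K k) * σ * (actRight X (K k))ᴴ) =
      traceSnd (Y := Y × Z) (σ * ((1 : Matrix X X ℂ) ⊗ₖ ((K k)ᴴ * K k))) := fun k => by
    rw [actRight_conjTranspose, actRight, actRight, Matrix.mul_assoc, traceSnd_one_kronecker_mul,
      Matrix.mul_assoc, ← Matrix.mul_kronecker_mul, Matrix.one_mul]
  rw [traceSnd_sum, Finset.sum_congr rfl fun k _ => h k, ← traceSnd_sum, ← Finset.mul_sum]
  have h2 : ∑ k, (1 : Matrix X X ℂ) ⊗ₖ ((K k)ᴴ * K k) = 1 := by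
    rw [← Matrix.one_kronecker_one, ← hK]
    ext x y
    simp only [Matrix.sum_apply, Matrix.kroneckerMap_apply, Finset.mul_sum]
  rw [h2, Matrix.mul_one]

theorem ketBra_mulVec [Fintype X] (T : Matrix X X ℂ) (v : X → ℂ) :
    T * ketBra v * Tᴴ = ketBra (T *ᵥ v) := by
  rw [ketBra, ketBra, Matrix.mul_vecMulVec, Matrix.vecMulVec_mul, Matrix.star_mulVec]

theorem ketBra_posSemidef [Fintype X] (v : X → ℂ) : (ketBra v).PosSemidef :=
  Matrix.posSemidef_vecMulVec_self_star v

theorem ketBra_kronecker (v : X → ℂ) (w : Y → ℂ) :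
    ketBra v ⊗ₖ ketBra w = ketBra (fun x : X × Y => v x.1 * w x.2) := by
  ext x y
  simp [ketBra, Matrix.vecMulVec_apply]
  ring

theorem trace_ketBra [Fintype X] {v : X → ℂ} (h : ∑ x, ‖v x‖ ^ 2 = 1) : (ketBra v).trace = 1 := by
  simp only [ketBra, Matrix.trace, Matrix.diag_apply, Matrix.vecMulVec_apply, Pi.star_apply,
    Complex.star_def, Complex.mul_conj, Complex.normSq_eq_norm_sq]
  exact_mod_cast h

/-- Two purifications of the same state are related by a unitary on the purifying register. -/
theorem exists_unitary_actRight [Fintype X] [Fintype Y] [DecidableEq X] [DecidableEq Y]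
    (φ χ : X × Y → ℂ)
    (h : traceSnd (ketBra φ) = traceSnd (ketBra χ)) :
    ∃ V ∈ Matrix.unitaryGroup Y ℂ, ((1 : Matrix X X ℂ) ⊗ₖ V) *ᵥ φ = χ := by
  -- With the amplitudes arranged as a `Y × X` matrix, the Gram matrix is the transpose of the
  -- marginal on `X`, hence the exchange of `x` and `x'`.
  obtain ⟨V, hV, hVX⟩ := Matrix.exists_unitary_mul_eq
    (Matrix.of fun (y : Y) (x : X) => φ (x, y)) (Matrix.of fun y x => χ (x, y)) (by
      ext x x'
      have := congrFun (congrFun h x') x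
      simpa [traceSnd, ketBra, Matrix.vecMulVec_apply, Matrix.mul_apply, mul_comm] using this)
  refine ⟨V, hV, ?_⟩
  ext ⟨x, y⟩
  have := congrFun (congrFun hVX y) x
  simpa [Matrix.mulVec, dotProduct, Matrix.mul_apply, Fintype.sum_prod_type, Matrix.one_apply,
    Finset.sum_comm (s := (Finset.univ : Finset X))] using this

open scoped MatrixOrder in
theorem Matrix.PosSemidef.exists_eq_mul_conjTranspose [Fintype X] [DecidableEq X] {ρ : Matrix X X ℂ}
    (h : ρ.PosSemidef) : ∃ C : Matrix X X ℂ, ρ = C * Cᴴ := by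
  obtain ⟨C, hC⟩ := CStarAlgebra.nonneg_iff_eq_star_mul_self.1 h.nonneg
  exact ⟨Cᴴ, by rw [hC, Matrix.conjTranspose_conjTranspose]; rfl⟩

/-- If `ρ = C * Cᴴ`, the columns of `C`, indexed by the workspace, are the components of a
purification. The dimension does not depend on `ρ`, so one workspace serves all rounds. -/
theorem exists_purification [Fintype X] [Fintype Y] [DecidableEq X] [DecidableEq Y]
    {ρ : Matrix (X × Y) (X × Y) ℂ}
    (h : ρ.PosSemidef) :
    ∃ φ : X × Y × Fin (Fintype.card (X × Y)) → ℂ, traceLast (ketBra φ) = ρ := by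
  obtain ⟨C, rfl⟩ := h.exists_eq_mul_conjTranspose
  let e := (Fintype.equivFin (X × Y)).symm
  refine ⟨fun x => C (x.1, x.2.1) (e x.2.2), ?_⟩
  ext x y
  simp only [traceLast, ketBra, Matrix.vecMulVec_apply, Matrix.mul_apply, Pi.star_apply,
    Matrix.conjTranspose_apply]
  exact e.sum_comp fun z => C x z * star (C y z)

end PartialTrace

/-! ### Runs against an honest party and feasible sequences -/

section HonestParty

variable {X Y : Type*} [Fintype X] [Fintype Y] [DecidableEq X] [DecidableEq Y]

/-- The state of `X ⊗ Y ⊗ ℂ^d` along an execution in which an honest party with private register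
`X` applies `K i` to `X ⊗ Y` in the rounds `i` with `p i`, and its opponent follows the strategy
`S` in the other rounds. -/
noncomputable def honestRun (p : ℕ → Prop) [DecidablePred p]
    (K : ℕ → Matrix (X × Y) (X × Y) ℂ) (ψ : X → ℂ) {d : ℕ} (S : CheatStrategy (Y × Fin d)) :
    ℕ → Matrix (X × Y × Fin d) (X × Y × Fin d) ℂ
  | 0 => ketBra ψ ⊗ₖ S.init
  | i + 1 =>
    if p (i + 1) then
      actLeft (Fin d) (K (i + 1)) * honestRun p K ψ S i * (actLeft (Fin d) (K (i + 1)))ᴴ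
    else
      ∑ k, actRight X (S.kraus (i + 1) k) * honestRun p K ψ S i *
        (actRight X (S.kraus (i + 1) k))ᴴ

/-- The constraints that honest operations `K i` in the rounds `i` with `p i` impose on the reduced
states `ρ 0, …, ρ n` of the honest private register and the message register. -/
structure HonestFeasible (p : ℕ → Prop) (K : ℕ → Matrix (X × Y) (X × Y) ℂ) (ψ : X → ℂ) (n : ℕ)
    (ρ : ℕ → Matrix (X × Y) (X × Y) ℂ) : Prop where
  pos : ∀ i ≤ n, (ρ i).PosSemidef
  start : traceSnd (ρ 0) = ketBra ψ
  honest : ∀ i < n, p (i + 1) →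
    traceSnd (ρ (i + 1)) = traceSnd (K (i + 1) * ρ i * (K (i + 1))ᴴ)
  cheat : ∀ i < n, ¬ p (i + 1) → traceSnd (ρ (i + 1)) = traceSnd (ρ i)

variable {p : ℕ → Prop} {K : ℕ → Matrix (X × Y) (X × Y) ℂ} {ψ : X → ℂ}

/-- The first operator of a feasible sequence has a purification of product form. -/
theorem HonestFeasible.exists_start [Nonempty X] [Nonempty Y] {n : ℕ}
    {ρ : ℕ → Matrix (X × Y) (X × Y) ℂ}
    (hρ : HonestFeasible p K ψ n ρ) (hψ : (ketBra ψ).trace = 1) :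
    ∃ ξ : Y × Fin (Fintype.card (X × Y)) → ℂ, (ketBra ξ).trace = 1 ∧
      traceLast (ketBra ψ ⊗ₖ ketBra ξ) = ρ 0 := by
  obtain ⟨φ, hφ⟩ := exists_purification (hρ.pos 0 (Nat.zero_le _))
  have : NeZero (Fintype.card (X × Y)) := ⟨Fintype.card_ne_zero⟩
  let e : Y × Fin (Fintype.card (X × Y)) → ℂ := Pi.single (Classical.arbitrary Y, 0) 1
  have he : (ketBra e).trace = 1 := trace_ketBra <| by
    rw [Finset.sum_eq_single (Classical.arbitrary Y, 0)] <;> simp +contextual [e]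
  -- Both `ψ ⊗ e` and `φ` purify `ketBra ψ`, so some `1 ⊗ V` maps the first to the second, and `φ =
  -- ψ ⊗ V e`.
  obtain ⟨V, hV, h⟩ := exists_unitary_actRight (fun x => ψ x.1 * e x.2) φ (by
    rw [← ketBra_kronecker, traceSnd_kronecker, he, one_smul, ← traceSnd_traceLast, hφ, hρ.start])
  have hprod : ketBra ψ ⊗ₖ ketBra (V *ᵥ e) = ketBra φ := by
    rw [← h, ketBra_kronecker]
    congr 1
    ext ⟨x, y⟩
    simp only [Matrix.mulVec, dotProduct, Fintype.sum_prod_type (α₁ := X), Matrix.one_apply,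
      Matrix.kroneckerMap_apply, Finset.mul_sum, ite_mul, one_mul, zero_mul]
    rw [Finset.sum_comm]
    simp only [Finset.sum_ite_eq, Finset.mem_univ, if_true]
    exact Finset.sum_congr rfl fun _ _ => by ring
  refine ⟨V *ᵥ e, ?_, by rw [hprod, hφ]⟩
  have h1 := trace_traceSnd (ρ 0)
  rw [hρ.start, hψ, ← hφ, ← trace_traceSnd, ← hprod, traceSnd_traceLast_kronecker,
    Matrix.trace_smul, hψ] at h1
  simpa using h1.symm

variable [DecidablePred p]

theorem honestRun_posSemidef {d : ℕ} (S : CheatStrategy (Y × Fin d)) (i : ℕ) :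
    (honestRun p K ψ S i).PosSemidef := by
  induction i with
  | zero => exact (ketBra_posSemidef ψ).kronecker S.init_density.1
  | succ i ih =>
    rw [honestRun]
    split_ifs
    · exact ih.mul_mul_conjTranspose_same _
    · exact Matrix.posSemidef_sum _ fun k _ => ih.mul_mul_conjTranspose_same _

/-- This half bounds every strategy by the program: honest operations act beside the workspace, and
the opponent's channels do not affect the marginal on `X`. -/
theorem honestRun_feasible {d : ℕ} (S : CheatStrategy (Y × Fin d)) (n : ℕ) :
    HonestFeasible p K ψ n fun i => traceLast (honestRun p K ψ S i) where
  pos i _ := traceLast_posSemidef (honestRun_posSemidef S i)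
  start := by
    rw [honestRun, traceSnd_traceLast_kronecker, S.init_density.2, one_smul]
  honest i _ hi := by
    rw [honestRun, if_pos hi, actLeft_conjTranspose, traceLast_mul_actLeft, traceLast_actLeft_mul]
  cheat i _ hi := by
    rw [honestRun, if_neg hi, traceSnd_traceLast, traceSnd_traceLast,
      traceSnd_sum_actRight _ (S.kraus_complete _)]

/-- Every feasible sequence is realised by a strategy of the opponent that starts with a given
purification of the first operator. -/
theorem HonestFeasible.exists_strategy {n : ℕ} {ρ : ℕ → Matrix (X × Y) (X × Y) ℂ}
    (hρ : HonestFeasible p K ψ n ρ) (hp : ∀ i, p (i + 2) → ¬ p (i + 1))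
    (ξ : Y × Fin (Fintype.card (X × Y)) → ℂ) (hξ : (ketBra ξ).trace = 1)
    (h0 : traceLast (ketBra ψ ⊗ₖ ketBra ξ) = ρ 0) :
    ∃ S : CheatStrategy (Y × Fin (Fintype.card (X × Y))), S.init = ketBra ξ ∧
      traceSnd (traceLast (honestRun p K ψ S n)) = traceSnd (ρ n) := by
  -- The purification at index `0` must be the prescribed product; the zero vector beyond `n` is a
  -- default.
  have hφ : ∀ i, ∃ φ : X × Y × Fin (Fintype.card (X × Y)) → ℂ,
      (i ≤ n → traceLast (ketBra φ) = ρ i) ∧ (i = 0 → ketBra φ = ketBra ψ ⊗ₖ ketBra ξ) := by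
    rintro (_ | i)
    · exact ⟨fun x => ψ x.1 * ξ x.2, fun _ => by rw [← h0, ketBra_kronecker],
        fun _ => (ketBra_kronecker ψ ξ).symm⟩
    · by_cases hi : i + 1 ≤ n
      · obtain ⟨φ, h⟩ := exists_purification (hρ.pos _ hi)
        exact ⟨φ, fun _ => h, fun h => by omega⟩
      · exact ⟨0, fun h => absurd h hi, fun h => by omega⟩
  choose φ hφ hφ0 using hφ
  let χ : ℕ → X × Y × Fin (Fintype.card (X × Y)) → ℂ
    | 0 => φ 0
    | i + 1 => if p (i + 1) then actLeft _ (K (i + 1)) *ᵥ φ i else φ (i + 1)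
  have hχ : ∀ i ≤ n, traceSnd (traceLast (ketBra (χ i))) = traceSnd (ρ i) := by
    rintro (_ | i) hi
    · rw [hφ 0 hi]
    · by_cases h : p (i + 1)
      · simp only [χ, if_pos h]
        rw [← ketBra_mulVec, actLeft_conjTranspose, traceLast_mul_actLeft, traceLast_actLeft_mul,
          hφ i (by omega), hρ.honest i hi h]
      · simp only [χ, if_neg h]
        rw [hφ _ hi]
  -- The identity fills the indices at which the strategy does not act, since a Kraus family is
  -- required everywhere.
  have hV : ∀ i, ∃ V ∈ Matrix.unitaryGroup (Y × Fin (Fintype.card (X × Y))) ℂ,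
      1 ≤ i → i ≤ n → ¬ p i → actRight X V *ᵥ χ (i - 1) = χ i := by
    rintro (_ | i)
    · exact ⟨1, one_mem _, fun h => by omega⟩
    · by_cases h : i + 1 ≤ n ∧ ¬ p (i + 1)
      · obtain ⟨V, hV, h'⟩ := exists_unitary_actRight (χ i) (χ (i + 1)) (by
          rw [← traceSnd_traceLast, ← traceSnd_traceLast, hχ i (by omega), hχ _ h.1,
            hρ.cheat i h.1 h.2])
        exact ⟨V, hV, fun _ _ _ => h'⟩
      · exact ⟨1, one_mem _, fun _ h1 h2 => absurd ⟨h1, h2⟩ h⟩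
  choose V hVu hV using hV
  let S : CheatStrategy (Y × Fin (Fintype.card (X × Y))) :=
    { init := ketBra ξ
      init_density := ⟨ketBra_posSemidef ξ, hξ⟩
      krausCount := fun _ => 1
      kraus := fun i _ => V i
      kraus_complete := fun i => by
        simpa [Matrix.star_eq_conjTranspose] using Matrix.mem_unitaryGroup_iff'.1 (hVu i) }
  refine ⟨S, rfl, ?_⟩
  have hrun : ∀ i ≤ n, honestRun p K ψ S i = ketBra (χ i) := by
    intro i
    induction i with
    | zero => exact fun _ => (hφ0 0 rfl).symm
    | succ i ih =>
      intro hi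
      rw [honestRun, ih (by omega)]
      by_cases h : p (i + 1)
      -- An honest round comes first or follows a round of the opponent, so it starts from the
      -- chosen purification.
      · have hχi : χ i = φ i := by
          rcases i with _ | i
          · rfl
          · exact if_neg (hp i h)
        rw [if_pos h, ketBra_mulVec, hχi]
        simp only [χ, if_pos h]
      · rw [if_neg h, ← hV (i + 1) (by omega) hi h]
        simp [S, ketBra_mulVec]
  rw [hrun n le_rfl, hχ n le_rfl]

end HonestParty

/-! ### Compactness of the feasible set and existence of the maximum -/

section Compactness

variable {X Y : Type*} [Fintype X]

/-- With `ρ = C * Cᴴ`, an entry is an inner product of two rows of `C`, at most the mean of their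
squared norms, each of which is bounded by the trace. -/
theorem Matrix.PosSemidef.norm_apply_le_trace [DecidableEq X] {ρ : Matrix X X ℂ}
    (h : ρ.PosSemidef) (x y : X) : ‖ρ x y‖ ≤ ρ.trace.re := by
  obtain ⟨C, rfl⟩ := h.exists_eq_mul_conjTranspose
  have hd : ∀ z, ((C * Cᴴ) z z).re = ∑ k, ‖C z k‖ ^ 2 := fun z => by
    simp only [Matrix.mul_apply, Matrix.conjTranspose_apply, Complex.star_def, Complex.mul_conj,
      Complex.normSq_eq_norm_sq, Complex.re_sum, Complex.ofReal_re]
  have ht : ∀ z, ∑ k, ‖C z k‖ ^ 2 ≤ (C * Cᴴ).trace.re := fun z => by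
    simp only [Matrix.trace, Matrix.diag_apply, Complex.re_sum, hd]
    exact Finset.single_le_sum (f := fun z => ∑ k, ‖C z k‖ ^ 2)
      (fun _ _ => by positivity) (Finset.mem_univ z)
  have h1 : ‖(C * Cᴴ) x y‖ ≤ ∑ k, (‖C x k‖ ^ 2 + ‖C y k‖ ^ 2) / 2 := by
    rw [Matrix.mul_apply]
    refine (norm_sum_le _ _).trans (Finset.sum_le_sum fun k _ => ?_)
    rw [Matrix.conjTranspose_apply, norm_mul, norm_star]
    linarith [two_mul_le_add_sq ‖C x k‖ ‖C y k‖]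
  rw [← Finset.sum_div, Finset.sum_add_distrib] at h1
  linarith [ht x, ht y]

theorem Matrix.isClosed_setOf_posSemidef : IsClosed {ρ : Matrix X X ℂ | ρ.PosSemidef} := by
  simp only [Matrix.posSemidef_iff_dotProduct_mulVec, Matrix.IsHermitian, Set.ofPred_and,
    Set.ofPred_forall]
  refine (isClosed_eq (by fun_prop) (by fun_prop)).inter (isClosed_iInter fun v => ?_)
  exact isClosed_le continuous_const (by fun_prop)

theorem continuous_traceSnd {X Y : Type*} [Fintype Y] :
    Continuous (traceSnd : Matrix (X × Y) (X × Y) ℂ → Matrix X X ℂ) := by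
  refine continuous_matrix fun x y => ?_
  unfold traceSnd
  fun_prop

variable [Fintype Y] [DecidableEq X] [DecidableEq Y]

/-- Entries are bounded by the trace, which the constraints express through the previous operator.
As `K` need not be contractive, the next bound comes from continuity on the compact box of the
previous step. -/
theorem HonestFeasible.exists_bound (p : ℕ → Prop) (K : ℕ → Matrix (X × Y) (X × Y) ℂ) (ψ : X → ℂ)
    (n i : ℕ) : ∃ c : ℝ, ∀ ρ, HonestFeasible p K ψ n ρ → i ≤ n → ∀ x y, ‖ρ i x y‖ ≤ c := by
  induction i with
  | zero =>
    refine ⟨(ketBra ψ).trace.re, fun ρ hρ hi x y => ?_⟩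
    rw [← hρ.start, trace_traceSnd]
    exact (hρ.pos 0 hi).norm_apply_le_trace x y
  | succ i ih =>
    obtain ⟨c, hc⟩ := ih
    let B : Set (Matrix (X × Y) (X × Y) ℂ) :=
      Set.univ.pi fun _ => Set.univ.pi fun _ => Metric.closedBall 0 c
    have hB : IsCompact B :=
      isCompact_univ_pi fun _ => isCompact_univ_pi fun _ => isCompact_closedBall 0 c
    have hf : Continuous fun ρ : Matrix (X × Y) (X × Y) ℂ =>
        (K (i + 1) * ρ * (K (i + 1))ᴴ).trace.re := by fun_prop
    have hg : Continuous fun ρ : Matrix (X × Y) (X × Y) ℂ => ρ.trace.re := by fun_prop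
    obtain ⟨c₁, h₁⟩ := (hB.image hf).bddAbove
    obtain ⟨c₂, h₂⟩ := (hB.image hg).bddAbove
    refine ⟨max c₁ c₂, fun ρ hρ hi x y => ?_⟩
    have hmem : ρ i ∈ B := fun x _ y _ => by
      simpa using hc ρ hρ (by omega) x y
    refine ((hρ.pos _ hi).norm_apply_le_trace x y).trans ?_
    by_cases h : p (i + 1)
    · rw [← trace_traceSnd, hρ.honest i hi h, trace_traceSnd]
      exact (h₁ ⟨_, hmem, rfl⟩).trans (le_max_left _ _)
    · rw [← trace_traceSnd, hρ.cheat i hi h, trace_traceSnd]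
      exact (h₂ ⟨_, hmem, rfl⟩).trans (le_max_right _ _)

/-- The closed set `C` accommodates both a free and a prescribed `ρ 0`. -/
theorem HonestFeasible.exists_isGreatest (p : ℕ → Prop) (K : ℕ → Matrix (X × Y) (X × Y) ℂ)
    (ψ : X → ℂ) (n : ℕ) (R : Matrix X X ℂ) {C : Set (Matrix (X × Y) (X × Y) ℂ)} (hC : IsClosed C)
    (hne : ∃ ρ, HonestFeasible p K ψ n ρ ∧ ρ 0 ∈ C) :
    ∃ v, IsGreatest {v | ∃ ρ, HonestFeasible p K ψ n ρ ∧ ρ 0 ∈ C ∧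
      v = (R * traceSnd (ρ n)).trace.re} v := by
  choose c hc using HonestFeasible.exists_bound p K ψ n
  -- Entries beyond `n` are unconstrained; setting them to zero makes the set bounded without
  -- changing the values.
  let F : Set (ℕ → Matrix (X × Y) (X × Y) ℂ) :=
    {ρ | HonestFeasible p K ψ n ρ ∧ ρ 0 ∈ C ∧ ∀ i, n < i → ρ i = 0}
  -- The maximum with `0` keeps the zero matrices beyond `n` inside the box, whatever the sign of `c
  -- i`.
  let B : Set (ℕ → Matrix (X × Y) (X × Y) ℂ) :=
    Set.univ.pi fun i => Set.univ.pi fun _ => Set.univ.pi fun _ => Metric.closedBall 0 (max (c i) 0)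
  have hB : IsCompact B := isCompact_univ_pi fun _ => isCompact_univ_pi fun _ =>
    isCompact_univ_pi fun _ => isCompact_closedBall 0 _
  have hFB : F ⊆ B := fun ρ hρ i _ x _ y _ => by
    rw [mem_closedBall_zero_iff]
    by_cases hi : i ≤ n
    · exact (hc i ρ hρ.1 hi x y).trans (le_max_left _ _)
    · rw [hρ.2.2 i (by omega)]; simp
  have hcont := continuous_traceSnd (X := X) (Y := Y)
  have hF : IsClosed F := by
    have : F = {ρ | (∀ i, i ≤ n → ρ i ∈ {ρ | ρ.PosSemidef}) ∧ traceSnd (ρ 0) = ketBra ψ ∧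
        (∀ i, i < n → p (i + 1) →
          traceSnd (ρ (i + 1)) = traceSnd (K (i + 1) * ρ i * (K (i + 1))ᴴ)) ∧
        (∀ i, i < n → ¬ p (i + 1) → traceSnd (ρ (i + 1)) = traceSnd (ρ i)) ∧
        ρ 0 ∈ C ∧ ∀ i, n < i → ρ i = 0} := by
      ext ρ
      exact ⟨fun ⟨⟨h1, h2, h3, h4⟩, h5, h6⟩ => ⟨h1, h2, h3, h4, h5, h6⟩,
        fun ⟨h1, h2, h3, h4, h5, h6⟩ => ⟨⟨h1, h2, h3, h4⟩, h5, h6⟩⟩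
    rw [this]
    simp only [Set.ofPred_and, Set.ofPred_forall]
    refine .inter ?_ <| .inter ?_ <| .inter ?_ <| .inter ?_ <| .inter ?_ ?_
    · exact isClosed_iInter fun i => isClosed_iInter fun _ =>
        Matrix.isClosed_setOf_posSemidef.preimage (continuous_apply i)
    · exact isClosed_eq (hcont.comp (continuous_apply 0)) continuous_const
    · exact isClosed_iInter fun i => isClosed_iInter fun _ => isClosed_iInter fun _ =>
        isClosed_eq (hcont.comp (continuous_apply _)) (hcont.comp (by fun_prop))
    · exact isClosed_iInter fun i => isClosed_iInter fun _ => isClosed_iInter fun _ =>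
        isClosed_eq (hcont.comp (continuous_apply _)) (hcont.comp (continuous_apply _))
    · exact hC.preimage (continuous_apply 0)
    · exact isClosed_iInter fun i => isClosed_iInter fun _ =>
        isClosed_eq (continuous_apply i) continuous_const
  have hval : Continuous fun ρ : ℕ → Matrix (X × Y) (X × Y) ℂ =>
      (R * traceSnd (ρ n)).trace.re := by
    have := hcont.comp (continuous_apply (A := fun _ : ℕ => Matrix (X × Y) (X × Y) ℂ) n)
    exact Complex.continuous_re.comp (continuous_const.matrix_mul this).matrix_trace
  let cut : (ℕ → Matrix (X × Y) (X × Y) ℂ) → ℕ → Matrix (X × Y) (X × Y) ℂ :=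
    fun ρ i => if i ≤ n then ρ i else 0
  have hcut : ∀ ρ, HonestFeasible p K ψ n ρ → ρ 0 ∈ C → cut ρ ∈ F := fun ρ hρ h0 => by
    have hle : ∀ i ≤ n, cut ρ i = ρ i := fun i hi => if_pos hi
    refine ⟨⟨fun i hi => ?_, ?_, fun i hi h => ?_, fun i hi h => ?_⟩, ?_, fun i hi => ?_⟩
    · rw [hle i hi]; exact hρ.pos i hi
    · rw [hle 0 (Nat.zero_le _)]; exact hρ.start
    · rw [hle i hi.le, hle (i + 1) hi]; exact hρ.honest i hi h
    · rw [hle i hi.le, hle (i + 1) hi]; exact hρ.cheat i hi h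
    · rw [hle 0 (Nat.zero_le _)]; exact h0
    · exact if_neg (by omega)
  have himage : {v | ∃ ρ, HonestFeasible p K ψ n ρ ∧ ρ 0 ∈ C ∧
      v = (R * traceSnd (ρ n)).trace.re} = (fun ρ => (R * traceSnd (ρ n)).trace.re) '' F := by
    ext v
    constructor
    · rintro ⟨ρ, hρ, h0, rfl⟩
      exact ⟨cut ρ, hcut ρ hρ h0, by simp [cut]⟩
    · rintro ⟨ρ, hρ, rfl⟩
      exact ⟨ρ, hρ.1, hρ.2.1, rfl⟩
  rw [himage]
  refine ((hB.of_isClosed_subset hF hFB).image hval).exists_isGreatest (Set.Nonempty.image _ ?_)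
  obtain ⟨ρ, hρ, h0⟩ := hne
  exact ⟨_, hcut ρ hρ h0⟩

end Compactness

/-! ### Exchange of registers -/

section Swap

variable {X Y Z : Type*}

/-- Reversal of the order of three registers. -/
def reverseRegisters (X Y Z : Type*) : X × Y × Z ≃ Z × Y × X where
  toFun x := (x.2.2, x.2.1, x.1)
  invFun x := (x.2.2, x.2.1, x.1)
  left_inv _ := rfl
  right_inv _ := rfl

theorem actLeft_eq_submatrix_actRight [DecidableEq Z] (T : Matrix (X × Y) (X × Y) ℂ) :
    actLeft Z T = (actRight Z (T.submatrix Prod.swap Prod.swap)).submatrix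
      (reverseRegisters X Y Z) (reverseRegisters X Y Z) := by
  ext x y
  simp [actLeft_apply, actRight, reverseRegisters, Matrix.one_apply]

theorem actRight_eq_submatrix_actLeft [DecidableEq X] (T : Matrix (Y × Z) (Y × Z) ℂ) :
    actRight X T = (actLeft X (T.submatrix Prod.swap Prod.swap)).submatrix
      (reverseRegisters X Y Z) (reverseRegisters X Y Z) := by
  ext x y
  simp [actLeft_apply, actRight, reverseRegisters, mul_comm]

theorem one_kronecker_submatrix_swap [DecidableEq X] (T : Matrix Y Y ℂ) :
    ((1 : Matrix X X ℂ) ⊗ₖ T).submatrix Prod.swap Prod.swap = T ⊗ₖ (1 : Matrix X X ℂ) := by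
  ext x y
  simp [Matrix.one_apply]

theorem Matrix.trace_submatrix_equiv {R : Type*} [AddCommMonoid R] [Fintype X] [Fintype Y]
    (e : X ≃ Y) (T : Matrix Y Y R) : (T.submatrix e e).trace = T.trace :=
  e.sum_comp fun y => T y y

/-- The same strategy after a relabelling of the registers. -/
def CheatStrategy.relabel [Fintype X] [DecidableEq X] [Fintype Y] [DecidableEq Y] (e : X ≃ Y)
    (S : CheatStrategy Y) : CheatStrategy X where
  init := S.init.submatrix e e
  init_density := ⟨S.init_density.1.submatrix e, by
    rw [Matrix.trace_submatrix_equiv, S.init_density.2]⟩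
  krausCount := S.krausCount
  kraus i k := (S.kraus i k).submatrix e e
  kraus_complete i := by
    simp only [Matrix.conjTranspose_submatrix, Matrix.submatrix_mul_equiv]
    rw [← Matrix.submatrix_one_equiv e, ← S.kraus_complete i]
    ext x y
    simp [Matrix.sum_apply]

/-- Makes relabelling surjective, so no strategy is lost in the reversed picture. -/
theorem CheatStrategy.relabel_prodComm [Fintype X] [DecidableEq X] [Fintype Y] [DecidableEq Y]
    (S : CheatStrategy (Y × X)) :
    (S.relabel (Equiv.prodComm X Y)).relabel (Equiv.prodComm Y X) = S := rfl

/-- The strategy that starts in the state `ρ` and leaves its registers untouched in every round. -/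
noncomputable def CheatStrategy.idle [Fintype X] [DecidableEq X] (ρ : Matrix X X ℂ)
    (hρ : IsDensityMatrix ρ) :
    CheatStrategy X where
  init := ρ
  init_density := hρ
  krausCount _ := 1
  kraus _ _ := 1
  kraus_complete _ := by simp

end Swap

/-! ### Translation of the protocol into honest runs -/

namespace PenWCFData

variable {A M B : Type*}

theorem runBob_eq_honestRun [Fintype A] [Fintype M] [DecidableEq A] [DecidableEq M]
    (P : PenWCFData A M B) {d : ℕ} (S : CheatStrategy (M × Fin d))
    (i : ℕ) : P.runBob S i = honestRun Odd (fun i => P.UA i * P.EA i) P.ψA S i := by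
  induction i with
  | zero => rfl
  | succ i ih => rw [runBob, honestRun, ih]

/-- Reversal puts Bob's register first, so cheating Alice becomes the opponent of an honest party
acting in the even rounds. -/
theorem runAlice_eq_honestRun [Fintype M] [Fintype B] [DecidableEq M] [DecidableEq B]
    (P : PenWCFData A M B) {d : ℕ} (S : CheatStrategy (Fin d × M))
    (i : ℕ) : P.runAlice S i =
      (honestRun Even (fun i => (P.UB i * P.EB i).submatrix Prod.swap Prod.swap) P.ψB
        (S.relabel (Equiv.prodComm M (Fin d))) i).submatrix
          (reverseRegisters (Fin d) M B) (reverseRegisters (Fin d) M B) := by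
  induction i with
  | zero =>
    ext x y
    simp [runAlice, honestRun, CheatStrategy.relabel, reverseRegisters, mul_comm]
  | succ i ih =>
    rw [runAlice, honestRun, ih]
    by_cases h : Odd (i + 1)
    · rw [if_pos h, if_neg (Nat.not_even_iff_odd.2 h)]
      simp only [actLeft_eq_submatrix_actRight, Matrix.conjTranspose_submatrix,
        Matrix.submatrix_mul_equiv]
      ext x y
      simp only [Matrix.sum_apply, Matrix.submatrix_apply]
      rfl
    · rw [if_neg h, if_pos (Nat.not_odd_iff_even.1 h)]
      simp only [actRight_eq_submatrix_actLeft, Matrix.conjTranspose_submatrix,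
        Matrix.submatrix_mul_equiv]

/-- The observable on Alice's register whose expectation is the number of points of Bob. -/
def payoffBob (P : PenWCFData A M B) (lam : ℝ) : Matrix A A ℂ :=
  ((lam + 1 : ℝ) : ℂ) • P.measA .one + (lam : ℂ) • P.measA .zero

/-- The observable on Bob's register whose expectation is the number of points of Alice. -/
def payoffAlice (P : PenWCFData A M B) (lam : ℝ) : Matrix B B ℂ :=
  ((lam + 1 : ℝ) : ℂ) • P.measB .zero + (lam : ℂ) • P.measB .one

theorem objectiveBob_eq [Fintype A] [Fintype M] [DecidableEq M]
    (P : PenWCFData A M B) (lam : ℝ) (ρ : Matrix (A × M) (A × M) ℂ) :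
    P.objectiveBob lam ρ = (P.payoffBob lam * traceSnd ρ).trace.re := by
  simp only [objectiveBob, payoffBob, trace_kronecker_one_mul, Matrix.add_mul, Matrix.smul_mul,
    Matrix.trace_add, Matrix.trace_smul, smul_eq_mul, Complex.add_re, Complex.re_ofReal_mul]

theorem trace_one_kronecker_mul [Fintype M] [Fintype B] [DecidableEq M] [DecidableEq B]
    (T : Matrix B B ℂ) (ρ : Matrix (M × B) (M × B) ℂ) :
    (((1 : Matrix M M ℂ) ⊗ₖ T) * ρ).trace =
      (T * traceSnd (ρ.submatrix Prod.swap Prod.swap)).trace := by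
  rw [← trace_kronecker_one_mul, ← Matrix.trace_submatrix_equiv (Equiv.prodComm B M),
    ← Matrix.submatrix_mul_equiv _ _ _ (Equiv.prodComm B M)]
  congr 2
  exact one_kronecker_submatrix_swap T

theorem objectiveAlice_eq [Fintype M] [Fintype B] [DecidableEq M] [DecidableEq B]
    (P : PenWCFData A M B) (lam : ℝ) (ρ : Matrix (M × B) (M × B) ℂ) :
    P.objectiveAlice lam ρ =
      (P.payoffAlice lam * traceSnd (ρ.submatrix Prod.swap Prod.swap)).trace.re := by
  simp only [objectiveAlice, payoffAlice, trace_one_kronecker_mul, Matrix.add_mul, Matrix.smul_mul,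
    Matrix.trace_add, Matrix.trace_smul, smul_eq_mul, Complex.add_re, Complex.re_ofReal_mul]

theorem _root_.CoinOutcome.sum_univ (f : CoinOutcome → ℝ) :
    ∑ x, f x = f .zero + f .one + f .abort := by
  change ∑ x ∈ {CoinOutcome.zero, CoinOutcome.one, CoinOutcome.abort}, f x = _
  simp [add_assoc]

theorem _root_.trace_actLeft_kronecker_one_mul {X Y Z : Type*} [Fintype X] [Fintype Y] [Fintype Z]
    [DecidableEq Y] [DecidableEq Z] (R : Matrix X X ℂ) (σ : Matrix (X × Y × Z) (X × Y × Z) ℂ) :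
    (actLeft Z (R ⊗ₖ (1 : Matrix Y Y ℂ)) * σ).trace = (R * traceSnd (traceLast σ)).trace := by
  rw [traceSnd_traceLast, ← trace_kronecker_one_mul]
  congr 2
  ext x y
  by_cases h : x.2.1 = y.2.1 <;> by_cases h' : x.2.2 = y.2.2 <;>
    simp [actLeft_apply, Matrix.one_apply, Prod.ext_iff, h, h']

/-- The abort probability is multiplied by zero points and drops out. -/
theorem rewardBob_eq [Fintype A] [Fintype M] [DecidableEq A] [DecidableEq M]
    (P : PenWCFData A M B) (n : ℕ) (lam : ℝ) {d : ℕ}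
    (S : CheatStrategy (M × Fin d)) :
    P.rewardBob n lam S = (P.payoffBob lam * traceSnd (traceLast
      (honestRun Odd (fun i => P.UA i * P.EA i) P.ψA S n))).trace.re := by
  rw [rewardBob, CoinOutcome.sum_univ]
  simp only [CoinOutcome.pointsBob, outcomeProbA, runBob_eq_honestRun,
    trace_actLeft_kronecker_one_mul, payoffBob, Matrix.add_mul, Matrix.smul_mul,
    Matrix.trace_add, Matrix.trace_smul, smul_eq_mul, Complex.add_re, Complex.re_ofReal_mul]
  simp only [reduceCtorEq, if_false]
  ring

theorem rewardAlice_eq [Fintype M] [Fintype B] [DecidableEq M] [DecidableEq B]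
    (P : PenWCFData A M B) (n : ℕ) (lam : ℝ) {d : ℕ}
    (S : CheatStrategy (Fin d × M)) :
    P.rewardAlice n lam S = (P.payoffAlice lam * traceSnd (traceLast
      (honestRun Even (fun i => (P.UB i * P.EB i).submatrix Prod.swap Prod.swap) P.ψB
        (S.relabel (Equiv.prodComm M (Fin d))) n))).trace.re := by
  have h : ∀ (T : Matrix B B ℂ),
      (actRight (Fin d) ((1 : Matrix M M ℂ) ⊗ₖ T) * P.runAlice S n).trace =
      (T * traceSnd (traceLast (honestRun Even
        (fun i => (P.UB i * P.EB i).submatrix Prod.swap Prod.swap) P.ψB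
        (S.relabel (Equiv.prodComm M (Fin d))) n))).trace := fun T => by
    rw [runAlice_eq_honestRun, actRight_eq_submatrix_actLeft, Matrix.submatrix_mul_equiv,
      Matrix.trace_submatrix_equiv, ← trace_actLeft_kronecker_one_mul]
    rw [one_kronecker_submatrix_swap]
  rw [rewardAlice, CoinOutcome.sum_univ]
  simp only [CoinOutcome.pointsAlice, outcomeProbB, h, payoffAlice, Matrix.add_mul,
    Matrix.smul_mul, Matrix.trace_add, Matrix.trace_smul, smul_eq_mul, Complex.add_re,
    Complex.re_ofReal_mul]
  simp only [reduceCtorEq, if_false]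
  ring

/-- Self-adjointness of the projector gives `E * Uᴴ = (U * E)ᴴ`. -/
theorem feasibleBob_iff [Fintype A] [Fintype M] [Fintype B] 
    [DecidableEq A] [DecidableEq M] [DecidableEq B]
    {P : PenWCFData A M B} {n : ℕ} (hP : P.IsProtocol n)
    (ρ : ℕ → Matrix (A × M) (A × M) ℂ) :
    P.FeasibleBob n ρ ↔ HonestFeasible Odd (fun i => P.UA i * P.EA i) P.ψA n ρ := by
  have hK : ∀ i < n, Odd (i + 1) → P.UA (i + 1) * P.EA (i + 1) * ρ i * P.EA (i + 1) *
      (P.UA (i + 1))ᴴ = P.UA (i + 1) * P.EA (i + 1) * ρ i *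
        (P.UA (i + 1) * P.EA (i + 1))ᴴ := fun i hi h => by
    have hE : (P.EA (i + 1))ᴴ = P.EA (i + 1) :=
      (hP.EA_proj (i + 1) (Finset.mem_Icc.2 ⟨by omega, hi⟩) h).isSelfAdjoint
    rw [Matrix.conjTranspose_mul, hE, ← Matrix.mul_assoc]
  constructor
  · intro h
    refine ⟨h.pos, h.start, fun i hi ho => ?_, fun i hi ho => ?_⟩
    · rw [← hK i hi ho]
      exact h.odd (i + 1) (Finset.mem_Icc.2 ⟨by omega, hi⟩) ho
    · exact h.even (i + 1) (Finset.mem_Icc.2 ⟨by omega, hi⟩) (Nat.not_odd_iff_even.1 ho)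
  · intro h
    refine ⟨h.pos, h.start, fun i hi ho => ?_, fun i hi ho => ?_⟩
    all_goals
      obtain ⟨i, rfl⟩ := Nat.exists_eq_add_of_le' (Finset.mem_Icc.1 hi).1
      have hi' : i < n := (Finset.mem_Icc.1 hi).2
    · rw [Nat.add_sub_cancel, hK i hi' ho]
      exact h.honest i hi' ho
    · exact h.cheat i hi' (Nat.not_odd_iff_even.2 ho)

theorem feasibleAlice_iff [Fintype A] [Fintype M] [Fintype B] 
    [DecidableEq A] [DecidableEq M] [DecidableEq B]
    {P : PenWCFData A M B} {n : ℕ} (hP : P.IsProtocol n)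
    (ρ : ℕ → Matrix (M × B) (M × B) ℂ) :
    P.FeasibleAlice n ρ ↔ HonestFeasible Even
      (fun i => (P.UB i * P.EB i).submatrix Prod.swap Prod.swap) P.ψB n
      (fun i => (ρ i).submatrix Prod.swap Prod.swap) := by
  have hK : ∀ i < n, Even (i + 1) → traceFst (P.UB (i + 1) * P.EB (i + 1) * ρ i * P.EB (i + 1) *
      (P.UB (i + 1))ᴴ) = traceSnd ((P.UB (i + 1) * P.EB (i + 1)).submatrix Prod.swap Prod.swap *
        (ρ i).submatrix Prod.swap Prod.swap *
        ((P.UB (i + 1) * P.EB (i + 1)).submatrix Prod.swap Prod.swap)ᴴ) := fun i hi h => by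
    have hE : (P.EB (i + 1))ᴴ = P.EB (i + 1) :=
      (hP.EB_proj (i + 1) (Finset.mem_Icc.2 ⟨by omega, hi⟩) h).isSelfAdjoint
    have hs : ∀ S T : Matrix (M × B) (M × B) ℂ, S.submatrix Prod.swap Prod.swap *
        T.submatrix Prod.swap Prod.swap = (S * T).submatrix Prod.swap Prod.swap := fun S T =>
      Matrix.submatrix_mul_equiv S T Prod.swap (Equiv.prodComm B M) Prod.swap
    rw [Matrix.conjTranspose_submatrix, hs, hs, Matrix.conjTranspose_mul, hE, ← Matrix.mul_assoc]
    rfl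
  constructor
  · intro h
    refine ⟨fun i hi => (h.pos i hi).submatrix _, h.start, fun i hi ho => ?_, fun i hi ho => ?_⟩
    · rw [← hK i hi ho]
      exact h.even (i + 1) (Finset.mem_Icc.2 ⟨by omega, hi⟩) ho
    · exact h.odd (i + 1) (Finset.mem_Icc.2 ⟨by omega, hi⟩) (Nat.not_even_iff_odd.1 ho)
  · intro h
    refine ⟨fun i hi => (h.pos i hi).submatrix Prod.swap, h.start, fun i hi ho => ?_,
      fun i hi ho => ?_⟩
    all_goals
      obtain ⟨i, rfl⟩ := Nat.exists_eq_add_of_le' (Finset.mem_Icc.1 hi).1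
      have hi' : i < n := (Finset.mem_Icc.1 hi).2
    · rw [Nat.add_sub_cancel, hK i hi' ho]
      exact h.honest i hi' ho
    · exact h.cheat i hi' (Nat.not_even_iff_odd.2 ho)

end PenWCFData

/-- Once rewards and program values form the same set, a maximum of the program yields both
attainment claims. -/
theorem IsGreatest.csSup_of_eq {s t : Set ℝ} {v : ℝ} (h : IsGreatest t v) (hst : s = t) :
    IsGreatest s (sSup s) ∧ IsGreatest t (sSup s) := by
  subst hst
  rw [h.csSup_eq]
  exact ⟨h, h⟩

theorem nonempty_of_trace_ketBra {X : Type*} [Fintype X] {v : X → ℂ}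
    (h : (ketBra v).trace = 1) : Nonempty X := by
  by_contra hX
  rw [not_nonempty_iff] at hX
  simp [Matrix.trace] at h

/-! ### Equality of reachable and feasible values -/

section Values

variable {X Y : Type*} [Fintype X] [Fintype Y] [DecidableEq X] [DecidableEq Y]
  {p : ℕ → Prop} [DecidablePred p] {K : ℕ → Matrix (X × Y) (X × Y) ℂ} {ψ : X → ℂ}

/-- The values reached by strategies are those of the feasible sequences. -/
theorem setOf_honestRun_eq (hp : ∀ i, p (i + 2) → ¬ p (i + 1)) [Nonempty X] [Nonempty Y]
    (hψ : (ketBra ψ).trace = 1) (n : ℕ) (R : Matrix X X ℂ) :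
    {r : ℝ | ∃ (d : ℕ) (S : CheatStrategy (Y × Fin d)),
      r = (R * traceSnd (traceLast (honestRun p K ψ S n))).trace.re} =
    {v | ∃ ρ, HonestFeasible p K ψ n ρ ∧ ρ 0 ∈ Set.univ ∧
      v = (R * traceSnd (ρ n)).trace.re} := by
  ext r
  constructor
  · rintro ⟨d, S, rfl⟩
    exact ⟨_, honestRun_feasible S n, trivial, rfl⟩
  · rintro ⟨ρ, hρ, -, rfl⟩
    obtain ⟨ξ, hξ, h0⟩ := hρ.exists_start hψ
    obtain ⟨S, -, hS⟩ := hρ.exists_strategy hp ξ hξ h0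
    exact ⟨_, S, by rw [hS]⟩

/-- Tracing out the normalised `τ` leaves exactly the prescribed `ρ 0`; conversely `ψ ⊗ η ⊗ e`, with
`e` a basis vector of the workspace, purifies it. -/
theorem setOf_honestRun_held_eq (hp : ∀ i, p (i + 2) → ¬ p (i + 1)) [Nonempty X] [Nonempty Y]
    (η : Y → ℂ) (hη : (ketBra η).trace = 1) (n : ℕ) (R : Matrix X X ℂ) :
    {r : ℝ | ∃ (d : ℕ) (S : CheatStrategy (Y × Fin d)),
      (∃ τ : Matrix (Fin d) (Fin d) ℂ, IsDensityMatrix τ ∧ S.init = ketBra η ⊗ₖ τ) ∧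
      r = (R * traceSnd (traceLast (honestRun p K ψ S n))).trace.re} =
    {v | ∃ ρ, HonestFeasible p K ψ n ρ ∧ ρ 0 ∈ ({ketBra ψ ⊗ₖ ketBra η} : Set _) ∧
      v = (R * traceSnd (ρ n)).trace.re} := by
  ext r
  constructor
  · rintro ⟨d, S, ⟨τ, hτ, hS⟩, rfl⟩
    refine ⟨_, honestRun_feasible S n, ?_, rfl⟩
    rw [Set.mem_singleton_iff, honestRun, hS, traceLast_kronecker_kronecker, hτ.2, one_smul]
  · rintro ⟨ρ, hρ, h0, rfl⟩
    have : NeZero (Fintype.card (X × Y)) := ⟨Fintype.card_ne_zero⟩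
    let e : Fin (Fintype.card (X × Y)) → ℂ := Pi.single 0 1
    have he : (ketBra e).trace = 1 := trace_ketBra <| by
      rw [Finset.sum_eq_single 0] <;> simp +contextual [e]
    obtain ⟨S, hS, hv⟩ := hρ.exists_strategy hp (fun x => η x.1 * e x.2)
      (by rw [← ketBra_kronecker, Matrix.trace_kronecker, hη, he, one_mul])
      (by rw [← ketBra_kronecker, traceLast_kronecker_kronecker, he, one_smul, h0])
    exact ⟨_, S, ⟨ketBra e, ⟨ketBra_posSemidef e, he⟩, by rw [hS, ketBra_kronecker]⟩, by rw [hv]⟩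

/-- Nonemptiness of the programs, witnessed by an idle opponent with one-dimensional workspace. -/
theorem exists_honestFeasible (η : Y → ℂ) (hη : (ketBra η).trace = 1) (n : ℕ) :
    ∃ ρ, HonestFeasible p K ψ n ρ ∧ ρ 0 = ketBra ψ ⊗ₖ ketBra η := by
  have h1 : IsDensityMatrix (1 : Matrix (Fin 1) (Fin 1) ℂ) := ⟨.one, by simp⟩
  refine ⟨_, honestRun_feasible (CheatStrategy.idle (ketBra η ⊗ₖ (1 : Matrix (Fin 1) (Fin 1) ℂ))
    ⟨(ketBra_posSemidef η).kronecker h1.1, by rw [Matrix.trace_kronecker, hη, h1.2, one_mul]⟩) n, ?_⟩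
  change traceLast (ketBra ψ ⊗ₖ (ketBra η ⊗ₖ (1 : Matrix (Fin 1) (Fin 1) ℂ))) = _
  rw [traceLast_kronecker_kronecker, h1.2, one_smul]

end Values

theorem mainTheorem8 {A M B : Type*} [Fintype A] [Fintype M] [Fintype B]
    [DecidableEq A] [DecidableEq M] [DecidableEq B]
    (P : PenWCFData A M B) (n : ℕ) (hP : P.IsProtocol n) (lam : ℝ) (hlam : 0 ≤ lam) :
    -- Bob's cheating reward is attained and is the maximum of the semidefinite program
    (IsGreatest (P.rewardsBob n lam) (P.RB n lam) ∧
      IsGreatest {v | ∃ ρ : ℕ → Matrix (A × M) (A × M) ℂ,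
        P.FeasibleBob n ρ ∧ v = P.objectiveBob lam (ρ n)} (P.RB n lam)) ∧
    -- Alice's cheating reward
    (IsGreatest (P.rewardsAlice n lam) (P.RA n lam) ∧
      IsGreatest {v | ∃ ρ : ℕ → Matrix (M × B) (M × B) ℂ,
        P.FeasibleAlice n ρ ∧ v = P.objectiveAlice lam (ρ n)} (P.RA n lam)) ∧
    -- Bob's cheating reward when Alice holds the message register in the state `ψM` at the start
    (IsGreatest (P.rewardsBobHeld n lam) (P.RBHeld n lam) ∧
      IsGreatest {v | ∃ ρ : ℕ → Matrix (A × M) (A × M) ℂ,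
        P.FeasibleBob n ρ ∧ ρ 0 = ketBra P.ψA ⊗ₖ ketBra P.ψM ∧
          v = P.objectiveBob lam (ρ n)} (P.RBHeld n lam)) := by
  have hA := trace_ketBra hP.norm_ψA
  have hM := trace_ketBra hP.norm_ψM
  have hB := trace_ketBra hP.norm_ψB
  have : Nonempty A := nonempty_of_trace_ketBra hA
  have : Nonempty M := nonempty_of_trace_ketBra hM
  have : Nonempty B := nonempty_of_trace_ketBra hB
  have hodd : ∀ i, Odd (i + 2) → ¬ Odd (i + 1) := fun i h h' => by
    rw [Nat.odd_iff] at h h'; omega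
  have heven : ∀ i, Even (i + 2) → ¬ Even (i + 1) := fun i h h' => by
    rw [Nat.even_iff] at h h'; omega
  refine ⟨?_, ?_, ?_⟩
  · obtain ⟨v, hv⟩ := HonestFeasible.exists_isGreatest Odd (fun i => P.UA i * P.EA i) P.ψA n
      (P.payoffBob lam) isClosed_univ
      (let ⟨ρ, hρ, _⟩ := exists_honestFeasible P.ψM hM n; ⟨ρ, hρ, trivial⟩)
    have hT : {v | ∃ ρ : ℕ → Matrix (A × M) (A × M) ℂ,
        P.FeasibleBob n ρ ∧ v = P.objectiveBob lam (ρ n)} =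
        {v | ∃ ρ, HonestFeasible Odd (fun i => P.UA i * P.EA i) P.ψA n ρ ∧ ρ 0 ∈ Set.univ ∧
          v = (P.payoffBob lam * traceSnd (ρ n)).trace.re} := by
      simp only [PenWCFData.feasibleBob_iff hP, PenWCFData.objectiveBob_eq, Set.mem_univ, true_and]
    rw [hT]
    refine IsGreatest.csSup_of_eq hv ?_
    rw [← setOf_honestRun_eq hodd hA]
    simp only [PenWCFData.rewardsBob, PenWCFData.rewardBob_eq]
  · obtain ⟨v, hv⟩ := HonestFeasible.exists_isGreatest Even
      (fun i => (P.UB i * P.EB i).submatrix Prod.swap Prod.swap) P.ψB n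
      (P.payoffAlice lam) isClosed_univ
      (let ⟨ρ, hρ, _⟩ := exists_honestFeasible P.ψM hM n; ⟨ρ, hρ, trivial⟩)
    have hT : {v | ∃ ρ : ℕ → Matrix (M × B) (M × B) ℂ,
        P.FeasibleAlice n ρ ∧ v = P.objectiveAlice lam (ρ n)} =
        {v | ∃ ρ, HonestFeasible Even
          (fun i => (P.UB i * P.EB i).submatrix Prod.swap Prod.swap) P.ψB n ρ ∧
          ρ 0 ∈ Set.univ ∧ v = (P.payoffAlice lam * traceSnd (ρ n)).trace.re} := by
      simp only [PenWCFData.feasibleAlice_iff hP, PenWCFData.objectiveAlice_eq]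
      ext v
      constructor
      · rintro ⟨ρ, hρ, h⟩
        exact ⟨_, hρ, trivial, h⟩
      -- The swap is an involution, so swapping `ρ` twice gives it back definitionally.
      · rintro ⟨ρ, hρ, -, h⟩
        exact ⟨fun i => (ρ i).submatrix Prod.swap Prod.swap, hρ, h⟩
    rw [hT]
    refine IsGreatest.csSup_of_eq hv ?_
    rw [← setOf_honestRun_eq heven hB]
    ext r
    constructor
    · rintro ⟨d, S, rfl⟩
      exact ⟨d, _, P.rewardAlice_eq n lam S⟩
    · rintro ⟨d, S, rfl⟩
      refine ⟨d, S.relabel (Equiv.prodComm (Fin d) M), ?_⟩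
      rw [P.rewardAlice_eq, CheatStrategy.relabel_prodComm]
  · obtain ⟨v, hv⟩ := HonestFeasible.exists_isGreatest Odd (fun i => P.UA i * P.EA i) P.ψA n
      (P.payoffBob lam) (isClosed_singleton (x := ketBra P.ψA ⊗ₖ ketBra P.ψM))
      (exists_honestFeasible P.ψM hM n)
    have hT : {v | ∃ ρ : ℕ → Matrix (A × M) (A × M) ℂ,
        P.FeasibleBob n ρ ∧ ρ 0 = ketBra P.ψA ⊗ₖ ketBra P.ψM ∧
          v = P.objectiveBob lam (ρ n)} =
        {v | ∃ ρ, HonestFeasible Odd (fun i => P.UA i * P.EA i) P.ψA n ρ ∧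
          ρ 0 ∈ ({ketBra P.ψA ⊗ₖ ketBra P.ψM} : Set _) ∧
          v = (P.payoffBob lam * traceSnd (ρ n)).trace.re} := by
      simp only [PenWCFData.feasibleBob_iff hP, PenWCFData.objectiveBob_eq, Set.mem_singleton_iff]
    rw [hT]
    refine IsGreatest.csSup_of_eq hv ?_
    rw [← setOf_honestRun_held_eq hodd _ hM]
    simp only [PenWCFData.rewardsBobHeld, PenWCFData.rewardBob_eq]
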